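/- Let $d\ge 0$ and let $\Omega\subset\mathbb{P}^d=\mathbb{P}(\mathbb{R}^{d+1})$ be a non-empty properly convex open set, i.e. an open set which is convex (equal to $\mathbb{P}^d$, or contained in an affine chart and convex there) and is contained and bounded in some affine chart. Let $\mathcal{C}_\Omega$ be the cone above $\Omega$, i.e. one of the connected components of the preimage of $\Omega$ in $\mathbb{R}^{d+1}\smallsetminus\{0\}$, and let $$\mathrm{Aut}(\Omega)=\{\gamma\in\mathrm{SL}_{d+1}(\mathbb{R}) : \gamma(\mathcal{C}_\Omega)=\mathcal{C}_\Omega\}$$ (this does not depend on the choice of the component). Let $d_\Omega$ be the Hilbert distance on $\Omega$: $d_\Omega(x,x)=0$ and, for $x\ne y$ in $\Omega$, $$d_\Omega(x,y)=\tfrac12\ln\frac{|py|\cdot|qx|}{|px|\cdot|qy|},$$ where $p,q$ are the points of the line $(xy)$ on $\partial\Omega$ such that $x$ is between $p$ and $y$, and $y$ is between $x$ and $q$, and $|\cdot|$ is a Euclidean norm on an affine chart containing $\overline\Omega$. For $\gamma\in\mathrm{Aut}(\Omega)$ put $\tau_\Omega(\gamma)=\inf_{x\in\Omega}d_\Omega(x,\gamma(x))$.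 Then, for every $\gamma\in\mathrm{Aut}(\Omega)$, the following are equivalent: 1. $\gamma$ is elliptic, i.e. $\tau_\Omega(\gamma)=0$ and the infimum is achieved at some point of $\Omega$; 2. $\gamma$ fixes a point of $\Omega$; 3. $\gamma$ is $\mathbb{S}^1$-semi-simple, i.e. $\gamma$ is diagonal in a suitable basis of $\mathbb{C}^{d+1}$ and all its complex eigenvalues have modulus $1$. -/

import Mathlib

open scoped LinearAlgebra.Projectivization Matrix Pointwise

noncomputable section

namespace HilbertGeometry

/-- The vector space `ℝ^{d+1}`. -/
abbrev Vec (d : ℕ) : Type := Fin (d + 1) → ℝ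

/-- The real projective space `ℙ^d`, the space of lines of `ℝ^{d+1}`. -/
abbrev ProjSpace (d : ℕ) : Type := ℙ ℝ (Vec d)

/-- The usual topology of `ℙ^d`: the quotient topology of `ℝ^{d+1} \ {0}`. -/
instance (d : ℕ) : TopologicalSpace (ProjSpace d) :=
  inferInstanceAs (TopologicalSpace (Quotient (projectivizationSetoid ℝ (Vec d))))

/-- The affine chart of `ℙ^d` which is the complement of the projective hyperplane `ℙ(ker f)`,
for a nonzero linear form `f`. -/
def chart {d : ℕ} (f : Vec d →ₗ[ℝ] ℝ) : Set (ProjSpace d) := {x | f x.rep ≠ 0}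

/-- The affine coordinate on `chart f`: the affine space structure of the chart is that of the
affine hyperplane `{v | f v = 1}`, and a line `x` of the chart is identified with its unique
point on this hyperplane. -/
def coord {d : ℕ} (f : Vec d →ₗ[ℝ] ℝ) (x : ProjSpace d) : Vec d := (f x.rep)⁻¹ • x.rep

/-- The affine coordinate can be computed from any vector spanning the line. -/
theorem coord_mk {d : ℕ} (f : Vec d →ₗ[ℝ] ℝ) (v : Vec d) (hv : v ≠ 0) :
    coord f (Projectivization.mk ℝ v hv) = (f v)⁻¹ • v := by
  obtain ⟨a, ha⟩ := Projectivization.exists_smul_eq_mk_rep ℝ v hv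
  have h0 : (a : ℝ) ≠ 0 := a.ne_zero
  unfold coord
  rw [← ha, Units.smul_def, map_smul, smul_eq_mul, mul_inv, smul_smul]
  congr 1
  field_simp

/-- A subset of `ℙ^d` is convex if it is `ℙ^d` itself or if it is contained in an affine chart and
convex there. -/
def IsConvex {d : ℕ} (S : Set (ProjSpace d)) : Prop :=
  S = Set.univ ∨ ∃ f : Vec d →ₗ[ℝ] ℝ, f ≠ 0 ∧ S ⊆ chart f ∧ Convex ℝ (coord f '' S)

/-- A convex subset of `ℙ^d` is properly convex if it is bounded in some affine chart. -/
def IsProperlyConvex {d : ℕ} (S : Set (ProjSpace d)) : Prop :=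
  IsConvex S ∧
    ∃ f : Vec d →ₗ[ℝ] ℝ, f ≠ 0 ∧ S ⊆ chart f ∧ Bornology.IsBounded (coord f '' S)

/-- The Euclidean distance `|uv|` between two vectors. -/
def euclDist {d : ℕ} (u v : Vec d) : ℝ := dist (WithLp.toLp 2 u) (WithLp.toLp 2 v)

/-- `r` is the Hilbert distance `½ ln (|py|·|qx| / (|px|·|qy|))` of two distinct points `x`, `y`,
computed in some affine chart containing the closure of `Ω`, where `p` and `q` are points of the
line `(xy)` on the boundary of `Ω` such that `x` is between `p` and `y` and `y` is between
`x` and `q`. -/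
def IsHilbertValue {d : ℕ} (Ω : Set (ProjSpace d)) (x y : ProjSpace d) (r : ℝ) : Prop :=
  ∃ (f : Vec d →ₗ[ℝ] ℝ) (p q : ProjSpace d),
    f ≠ 0 ∧ closure Ω ⊆ chart f ∧ p ∈ frontier Ω ∧ q ∈ frontier Ω ∧
    Sbtw ℝ (coord f p) (coord f x) (coord f y) ∧
    Sbtw ℝ (coord f x) (coord f y) (coord f q) ∧
    r = 1 / 2 * Real.log
      ((euclDist (coord f p) (coord f y) * euclDist (coord f q) (coord f x)) /
        (euclDist (coord f p) (coord f x) * euclDist (coord f q) (coord f y)))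

open Classical in
/-- The Hilbert distance on a properly convex open set `Ω`. For distinct `x`, `y` in `Ω` there is
exactly one value `r` with `IsHilbertValue Ω x y r`, because the cross-ratio does not depend on
the chart; the value `0` otherwise is only used for `x = y`. -/
def hilbertDist {d : ℕ} (Ω : Set (ProjSpace d)) (x y : ProjSpace d) : ℝ :=
  if h : x ≠ y ∧ ∃ r, IsHilbertValue Ω x y r then h.2.choose else 0

/-- The preimage of `Ω` in `ℝ^{d+1} \ {0}` under the projection to `ℙ^d`. -/
def preimageCone {d : ℕ} (Ω : Set (ProjSpace d)) : Set (Vec d) :=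
  {v | ∃ hv : v ≠ 0, Projectivization.mk ℝ v hv ∈ Ω}

/-- `C` is a cone above `Ω`: a connected component of the preimage of `Ω` in `ℝ^{d+1} \ {0}`. -/
def IsConeAbove {d : ℕ} (Ω : Set (ProjSpace d)) (C : Set (Vec d)) : Prop :=
  ∃ v ∈ preimageCone Ω, C = connectedComponentIn (preimageCone Ω) v

/-- The group `Aut(Ω)` of elements of `SL_{d+1}(ℝ)` that preserve the cone above `Ω`. -/
def Aut {d : ℕ} (Ω : Set (ProjSpace d)) : Subgroup (Matrix.SpecialLinearGroup (Fin (d + 1)) ℝ) :=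
  ⨅ (C : Set (Vec d)) (_ : IsConeAbove Ω C), MulAction.stabilizer _ C

/-- The translation length `inf_{x ∈ Ω} d_Ω(x, γ x)`. -/
def translationLength {d : ℕ} (Ω : Set (ProjSpace d))
    (γ : Matrix.SpecialLinearGroup (Fin (d + 1)) ℝ) : ℝ :=
  ⨅ x : Ω, hilbertDist Ω (x : ProjSpace d) (γ • (x : ProjSpace d))

/-- `γ` is elliptic: its translation length is `0` and the infimum is achieved. -/
def IsElliptic {d : ℕ} (Ω : Set (ProjSpace d))
    (γ : Matrix.SpecialLinearGroup (Fin (d + 1)) ℝ) : Prop :=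
  translationLength Ω γ = 0 ∧ ∃ x ∈ Ω, hilbertDist Ω x (γ • x) = translationLength Ω γ

/-- The complex linear map of `ℂ^{d+1}` with the same matrix as `γ`. -/
def complexify {d : ℕ} (γ : Matrix.SpecialLinearGroup (Fin (d + 1)) ℝ) :
    (Fin (d + 1) → ℂ) →ₗ[ℂ] (Fin (d + 1) → ℂ) :=
  Matrix.toLin' ((γ : Matrix (Fin (d + 1)) (Fin (d + 1)) ℝ).map (algebraMap ℝ ℂ))

/-- `γ` is `ℂ`-semi-simple: its matrix in a suitable basis of `ℂ^{d+1}` is diagonal. -/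
def IsComplexSemisimple {d : ℕ} (γ : Matrix.SpecialLinearGroup (Fin (d + 1)) ℝ) : Prop :=
  ∃ b : Module.Basis (Fin (d + 1)) ℂ (Fin (d + 1) → ℂ),
    (LinearMap.toMatrix b b (complexify γ)).IsDiag

/-- `γ` is `𝕊¹`-semi-simple: it is `ℂ`-semi-simple and all its eigenvalues have modulus one. -/
def IsCircleSemisimple {d : ℕ} (γ : Matrix.SpecialLinearGroup (Fin (d + 1)) ℝ) : Prop :=
  IsComplexSemisimple γ ∧ ∀ μ : ℂ, Module.End.HasEigenvalue (complexify γ) μ → ‖μ‖ = 1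

end HilbertGeometry

end

namespace HilbertGeometry

/-- All powers of `T` are bi-Lipschitz, with a common constant. -/
def HasBoundedPowers {𝕜 E : Type*} [NormedField 𝕜] [NormedAddCommGroup E] [NormedSpace 𝕜 E]
    (T : Module.End 𝕜 E) : Prop :=
  ∃ M : ℝ, 0 < M ∧ ∀ (n : ℕ) (w : E), ‖(T ^ n) w‖ ≤ M * ‖w‖ ∧ ‖w‖ ≤ M * ‖(T ^ n) w‖

section FixedPoint

variable {E : Type*} [NormedAddCommGroup E] [NormedSpace ℝ E]

theorem convex_setOf_ball_subset {C : Set E} (hC : Convex ℝ C) (δ : ℝ) :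
    Convex ℝ {z | Metric.ball z δ ⊆ C} := by
  intro x hx y hy a b ha hb hab z hz
  have hz' : ‖z - (a • x + b • y)‖ < δ := by simpa [dist_eq_norm] using hz
  set e := z - (a • x + b • y) with he
  have h1 : x + e ∈ C := hx (by simpa [dist_eq_norm] using hz')
  have h2 : y + e ∈ C := hy (by simpa [dist_eq_norm] using hz')
  have h3 := hC h1 h2 ha hb hab
  have : a • (x + e) + b • (y + e) = z := by
    have : a • e + b • e = e := by rw [← add_smul, hab, one_smul]
    calc a • (x + e) + b • (y + e) = (a • x + b • y) + (a • e + b • e) := by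
          simp only [smul_add]; abel
      _ = z := by rw [this, he]; abel
  rwa [this] at h3

variable [FiniteDimensional ℝ E]

/-- A map with bounded powers which preserves an open convex set fixes a point of it. -/
theorem HasBoundedPowers.exists_fixed_mem {T : Module.End ℝ E} (hT : HasBoundedPowers T)
    {C : Set E} (hCo : IsOpen C) (hCc : Convex ℝ C) (hTC : ∀ v ∈ C, T v ∈ C)
    (hne : C.Nonempty) : ∃ w ∈ C, T w = w := by
  obtain ⟨M, hM, hT⟩ := hT
  obtain ⟨v, hv⟩ := hne
  obtain ⟨ε, hε, hball⟩ := Metric.isOpen_iff.1 hCo v hv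
  have hpow : ∀ (n : ℕ), ∀ u ∈ C, (T ^ n) u ∈ C := by
    intro n
    induction n with
    | zero => simp
    | succ n ih => intro u hu; rw [pow_succ']; exact hTC _ (ih u hu)
  have hδ : 0 < ε / M := by positivity
  have hK : ∀ n : ℕ, (T ^ n) v ∈ {z | Metric.ball z (ε / M) ⊆ C} := by
    intro n z hz
    have hinj : Function.Injective (T ^ n) := by
      rw [← LinearMap.ker_eq_bot, LinearMap.ker_eq_bot']
      intro m hm
      have := (hT n m).2
      rw [hm] at this
      simpa using this
    obtain ⟨u, rfl⟩ := LinearMap.injective_iff_surjective.1 hinj z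
    apply hpow
    apply hball
    rw [Metric.mem_ball, dist_eq_norm] at hz ⊢
    rw [← map_sub] at hz
    calc ‖u - v‖ ≤ M * ‖(T ^ n) (u - v)‖ := (hT n _).2
      _ < M * (ε / M) := by gcongr
      _ = ε := by field_simp
  let w : ℕ → E := fun n ↦ ∑ k ∈ Finset.range (n + 1), ((n : ℝ) + 1)⁻¹ • (T ^ k) v
  have hw : ∀ n, w n ∈ {z | Metric.ball z (ε / M) ⊆ C} := by
    intro n
    refine (convex_setOf_ball_subset hCc _).sum_mem (fun _ _ ↦ by positivity) ?_ fun k _ ↦ hK k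
    simp only [Finset.sum_const, Finset.card_range, nsmul_eq_mul]
    push_cast
    field_simp
  have hbd : ∀ n, w n ∈ Metric.closedBall (0 : E) (M * ‖v‖) := by
    intro n
    refine (convex_closedBall (0 : E) _).sum_mem (fun _ _ ↦ by positivity) ?_ fun k _ ↦ ?_
    · simp only [Finset.sum_const, Finset.card_range, nsmul_eq_mul]
      push_cast
      field_simp
    · simpa using (hT k v).1
  have hdiff : ∀ n, T (w n) - w n = ((n : ℝ) + 1)⁻¹ • ((T ^ (n + 1)) v - v) := by
    intro n
    simp only [w, map_sum, map_smul, ← Finset.smul_sum, ← smul_sub]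
    congr 1
    rw [← Finset.sum_sub_distrib]
    have : ∀ k, T ((T ^ k) v) = (T ^ (k + 1)) v := fun k ↦ by rw [pow_succ']; rfl
    simp only [this]
    rw [Finset.sum_range_sub (fun k ↦ (T ^ k) v)]
    simp
  have hlim0 : Filter.Tendsto (fun n ↦ T (w n) - w n) Filter.atTop (nhds 0) := by
    have h1 : Filter.Tendsto (fun n : ℕ ↦ ((n : ℝ) + 1)⁻¹ * (M * ‖v‖ + ‖v‖)) Filter.atTop
        (nhds 0) := by
      have := (tendsto_one_div_add_atTop_nhds_zero_nat (𝕜 := ℝ)).mul_const (M * ‖v‖ + ‖v‖)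
      simpa using this
    refine squeeze_zero_norm (fun n ↦ ?_) h1
    rw [hdiff, norm_smul, Real.norm_of_nonneg (by positivity)]
    gcongr
    exact (norm_sub_le _ _).trans (by gcongr; exact (hT _ v).1)
  obtain ⟨z, -, φ, hφ, hz⟩ := tendsto_subseq_of_bounded Metric.isBounded_closedBall hbd
  refine ⟨z, ?_, ?_⟩
  · obtain ⟨n, hn⟩ := (hz.eventually (Metric.ball_mem_nhds z hδ)).exists
    exact hw (φ n) (by rwa [Metric.mem_ball, dist_comm])
  · have hc : Continuous T := T.continuous_of_finiteDimensional
    have h1 := ((hc.tendsto z).comp hz).sub hz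
    have h2 := hlim0.comp hφ.tendsto_atTop
    exact sub_eq_zero.1 (tendsto_nhds_unique h1 h2)

/-- A unimodular map which preserves a sharp open convex cone and has an eigenvector in it has
bounded powers, and the eigenvalue is `1`. -/
theorem hasBoundedPowers_of_eigenvector_mem_cone {T : Module.End ℝ E}
    (hdet : LinearMap.det T = 1) {C : Set E} (hCo : IsOpen C)
    (hCs : ∀ a : ℝ, 0 < a → ∀ v ∈ C, a • v ∈ C) {g : E →ₗ[ℝ] ℝ} {R : ℝ} (hR : 0 < R)
    (hg : ∀ v ∈ C, 0 < g v) (hgR : ∀ v ∈ C, ‖v‖ ≤ R * g v) (hTC : ∀ v, T v ∈ C ↔ v ∈ C)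
    {v : E} (hv : v ∈ C) {c : ℝ} (hTv : T v = c • v) (hv0 : v ≠ 0) : HasBoundedPowers T := by
  have hc : 0 < c := by
    have h1 := hg _ ((hTC v).2 hv)
    rw [hTv, map_smul, smul_eq_mul] at h1
    exact pos_of_mul_pos_left h1 (hg v hv).le
  have hCs' : ∀ a : ℝ, 0 < a → ∀ v, a • v ∈ C ↔ v ∈ C := fun a ha v ↦
    ⟨fun h ↦ by simpa [smul_smul, ha.ne'] using hCs a⁻¹ (inv_pos.2 ha) _ h, hCs a ha v⟩
  set K : Set E := {w | v + w ∈ C ∧ v - w ∈ C} with hKdef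
  have hKo : IsOpen K := by
    apply IsOpen.inter
    · exact hCo.preimage (by fun_prop : Continuous fun w ↦ v + w)
    · exact hCo.preimage (by fun_prop : Continuous fun w ↦ v - w)
  have h0K : (0 : E) ∈ K := by simpa [hKdef] using hv
  set B := 2 * R * g v + ‖v‖ with hB
  have hKB : ∀ w ∈ K, ‖w‖ ≤ B := by
    rintro w ⟨h1, h2⟩
    have h3 := hg _ h2
    have h4 := hgR _ h1
    rw [map_sub] at h3
    rw [map_add] at h4
    have h5 : ‖w‖ ≤ ‖v + w‖ + ‖v‖ := by
      simpa using norm_sub_le (v + w) v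
    nlinarith
  have hgv := hg v hv
  have hBpos : 0 < B := by positivity
  have hTK : ∀ w, T w ∈ c • K ↔ w ∈ K := by
    intro w
    rw [Set.mem_smul_set_iff_inv_smul_mem₀ hc.ne']
    simp only [hKdef, Set.mem_ofPred_eq]
    have e1 : v + c⁻¹ • T w = c⁻¹ • T (v + w) := by
      rw [map_add, hTv, smul_add, smul_smul, inv_mul_cancel₀ hc.ne', one_smul]
    have e2 : v - c⁻¹ • T w = c⁻¹ • T (v - w) := by
      rw [map_sub, hTv, smul_sub, smul_smul, inv_mul_cancel₀ hc.ne', one_smul]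
    rw [e1, e2, hCs' _ (inv_pos.2 hc), hCs' _ (inv_pos.2 hc), hTC, hTC]
  have hsurj : Function.Surjective T := by
    have : IsUnit T := by
      rw [LinearMap.isUnit_iff_isUnit_det, hdet]; exact isUnit_one
    exact ((Module.End.isUnit_iff _).1 this).2
  have hc1 : c = 1 := by
    let _ : MeasurableSpace E := borel E
    have _ : BorelSpace E := ⟨rfl⟩
    let μ : MeasureTheory.Measure E := MeasureTheory.Measure.addHaar
    have himg : T '' K = c • K := by
      ext y
      obtain ⟨w, rfl⟩ := hsurj y
      rw [hTK]
      constructor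
      · rintro ⟨w', h', e⟩
        rw [← hTK, ← e, hTK]; exact h'
      · exact fun h ↦ ⟨w, h, rfl⟩
    have h1 := MeasureTheory.Measure.addHaar_image_linearMap μ T K
    rw [himg, MeasureTheory.Measure.addHaar_smul, hdet] at h1
    have hpos : μ K ≠ 0 := (hKo.measure_pos μ ⟨0, h0K⟩).ne'
    have hfin : μ K ≠ ⊤ := by
      have : Bornology.IsBounded K := isBounded_iff_forall_norm_le.2 ⟨B, hKB⟩
      exact this.measure_lt_top.ne
    have h2 := (ENNReal.mul_left_inj hpos hfin).1 h1
    rw [abs_one, ENNReal.ofReal_one, ENNReal.ofReal_eq_one, abs_of_pos (by positivity)] at h2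
    have : Nontrivial E := ⟨⟨v, 0, hv0⟩⟩
    exact (pow_eq_one_iff_of_nonneg hc.le Module.finrank_pos.ne').1 h2
  subst hc1
  simp only [one_smul] at hTK
  have hTKn : ∀ n : ℕ, ∀ w, (T ^ n) w ∈ K ↔ w ∈ K := by
    intro n
    induction n with
    | zero => simp
    | succ n ih => intro w; rw [pow_succ', Module.End.mul_apply, hTK, ih]
  obtain ⟨ε, hε, hball⟩ := Metric.isOpen_iff.1 hKo 0 h0K
  have key : ∀ x y : E, (∀ a : ℝ, a • x ∈ K → ‖a • y‖ ≤ B) → ‖y‖ ≤ 2 * B / ε * ‖x‖ := by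
    intro x y h
    rcases eq_or_ne x 0 with rfl | hx
    · have hy : y = 0 := by
        by_contra hy
        have hy' : 0 < ‖y‖ := norm_pos_iff.2 hy
        have := h ((B + 1) / ‖y‖) (by simpa using h0K)
        rw [norm_smul, Real.norm_of_nonneg (by positivity), div_mul_cancel₀ _ hy'.ne'] at this
        linarith
      simp [hy]
    · have hx' : 0 < ‖x‖ := norm_pos_iff.2 hx
      have := h (ε / (2 * ‖x‖)) (hball (by
        rw [mem_ball_zero_iff, norm_smul, Real.norm_of_nonneg (by positivity)]
        have : ε / (2 * ‖x‖) * ‖x‖ = ε / 2 := by field_simp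
        linarith))
      rw [norm_smul, Real.norm_of_nonneg (by positivity)] at this
      rw [div_mul_eq_mul_div, div_le_iff₀ (by positivity)] at this
      rw [div_mul_eq_mul_div, le_div_iff₀ hε]
      linarith
  refine ⟨2 * B / ε, by positivity, fun n w ↦ ⟨key _ _ fun a ha ↦ ?_, key _ _ fun a ha ↦ ?_⟩⟩
  · rw [← map_smul]
    exact hKB _ ((hTKn n _).2 ha)
  · rw [← map_smul, hTKn] at ha
    exact hKB _ ha

end FixedPoint

section Complex

variable {E : Type*} [NormedAddCommGroup E] [NormedSpace ℂ E]

theorem eq_zero_of_forall_nat_mul_norm_le {F : Type*} [NormedAddCommGroup F] {u : F} {B : ℝ}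
    (h : ∀ n : ℕ, ((n : ℝ) + 1) * ‖u‖ ≤ B) : u = 0 := by
  by_contra hu
  have hu' : 0 < ‖u‖ := norm_pos_iff.2 hu
  obtain ⟨n, hn⟩ := exists_nat_gt (B / ‖u‖)
  rw [div_lt_iff₀ hu'] at hn
  nlinarith [h n]

theorem HasBoundedPowers.norm_eigenvalue {A : Module.End ℂ E} (hA : HasBoundedPowers A) {μ : ℂ}
    {w : E} (hw : A w = μ • w) (hw0 : w ≠ 0) : ‖μ‖ = 1 := by
  obtain ⟨M, hM, hA⟩ := hA
  have hw' : 0 < ‖w‖ := norm_pos_iff.2 hw0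
  have hpow : ∀ n : ℕ, (A ^ n) w = μ ^ n • w := by
    intro n
    induction n with
    | zero => simp
    | succ n ih => rw [pow_succ', Module.End.mul_apply, ih, map_smul, hw, smul_smul, pow_succ]
  have h1 : ∀ n : ℕ, ‖μ‖ ^ n ≤ M := fun n ↦ by
    have := (hA n w).1
    rw [hpow, norm_smul, norm_pow] at this
    exact le_of_mul_le_mul_right this hw'
  have h2 : ∀ n : ℕ, 1 ≤ M * ‖μ‖ ^ n := fun n ↦ by
    have := (hA n w).2
    rw [hpow, norm_smul, norm_pow, ← mul_assoc] at this
    exact le_of_mul_le_mul_right (by linarith) hw'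
  apply le_antisymm
  · by_contra! h
    obtain ⟨n, hn⟩ := pow_unbounded_of_one_lt M h
    exact absurd (h1 n) (not_le.2 hn)
  · by_contra! h
    obtain ⟨n, hn⟩ := exists_pow_lt_of_lt_one (inv_pos.2 hM) h
    have := h2 n
    have : M * ‖μ‖ ^ n < M * M⁻¹ := by gcongr
    rw [mul_inv_cancel₀ hM.ne'] at this
    linarith [h2 n]

theorem HasBoundedPowers.apply_eq_smul_of_sq {A : Module.End ℂ E} (hA : HasBoundedPowers A)
    {μ : ℂ} {w : E} (hw : A (A w - μ • w) = μ • (A w - μ • w)) : A w = μ • w := by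
  set u := A w - μ • w with hu
  have hAw : A w = μ • w + u := by rw [hu]; abel
  suffices u = 0 by rw [hAw, this, add_zero]
  by_contra hu0
  have hμ := hA.norm_eigenvalue hw hu0
  obtain ⟨M, hM, hA⟩ := hA
  have hpow : ∀ n : ℕ, (A ^ (n + 1)) w = μ ^ (n + 1) • w + (((n : ℂ) + 1) * μ ^ n) • u := by
    intro n
    induction n with
    | zero => simp [hAw]
    | succ n ih =>
      rw [pow_succ', Module.End.mul_apply, ih, map_add, map_smul, map_smul, hAw, hw]
      push_cast
      module
  refine hu0 (eq_zero_of_forall_nat_mul_norm_le (B := M * ‖w‖ + ‖w‖) fun n ↦ ?_)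
  have h1 := (hA (n + 1) w).1
  have h2 : (((n : ℂ) + 1) * μ ^ n) • u = (A ^ (n + 1)) w - μ ^ (n + 1) • w := by
    rw [hpow]; abel
  have h3 : ‖(((n : ℂ) + 1) * μ ^ n) • u‖ = ((n : ℝ) + 1) * ‖u‖ := by
    rw [norm_smul, norm_mul, norm_pow, hμ, one_pow, mul_one]
    congr 1
    exact_mod_cast Complex.norm_natCast (n + 1)
  rw [← h3, h2]
  refine (norm_sub_le _ _).trans ?_
  rw [norm_smul, norm_pow, hμ, one_pow, one_mul]
  gcongr

theorem HasBoundedPowers.iSup_eigenspace_eq_top [FiniteDimensional ℂ E] {A : Module.End ℂ E}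
    (hA : HasBoundedPowers A) : ⨆ μ, A.eigenspace μ = ⊤ := by
  rw [eq_top_iff, ← Module.End.iSup_maxGenEigenspace_eq_top A]
  refine iSup_mono fun μ w hw ↦ ?_
  rw [Module.End.mem_maxGenEigenspace] at hw
  obtain ⟨k, hk⟩ := hw
  rw [Module.End.mem_eigenspace_iff]
  induction k with
  | zero => simp_all
  | succ k ih =>
    rcases k with _ | k
    · simpa [sub_eq_zero] using hk
    · apply ih
      set x := ((A - μ • 1) ^ k) w with hx
      have e1 : ((A - μ • 1) ^ (k + 1)) w = A x - μ • x := by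
        rw [pow_succ', Module.End.mul_apply]; simp [hx]
      have e2 : ((A - μ • 1) ^ (k + 1 + 1)) w = A (A x - μ • x) - μ • (A x - μ • x) := by
        rw [pow_succ', Module.End.mul_apply, e1]; simp
      rw [e2, sub_eq_zero] at hk
      rw [e1, hA.apply_eq_smul_of_sq hk, sub_self]

theorem HasBoundedPowers.exists_eigenbasis {n : ℕ} {A : Module.End ℂ (Fin n → ℂ)}
    (hA : HasBoundedPowers A) : ∃ b : Module.Basis (Fin n) ℂ (Fin n → ℂ),
      (LinearMap.toMatrix b b A).IsDiag := by
  let s : Set (Fin n → ℂ) := {w | ∃ μ : ℂ, A w = μ • w}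
  have hs : ⊤ ≤ Submodule.span ℂ s := by
    rw [← hA.iSup_eigenspace_eq_top]
    exact iSup_le fun μ w hw ↦ Submodule.subset_span ⟨μ, Module.End.mem_eigenspace_iff.1 hw⟩
  let b₀ := Module.Basis.ofSpan hs
  let b := b₀.reindex (b₀.indexEquiv (Pi.basisFun ℂ (Fin n)))
  have hb : ∀ j, ∃ μ : ℂ, A (b j) = μ • b j := fun j ↦
    Module.Basis.ofSpan_subset hs (by rw [Module.Basis.reindex_apply]; exact ⟨_, rfl⟩)
  refine ⟨b, fun i j hij ↦ ?_⟩
  obtain ⟨μ, hμ⟩ := hb j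
  rw [LinearMap.toMatrix_apply, hμ, map_smul, Module.Basis.repr_self]
  simp [hij.symm]

theorem hasBoundedPowers_of_isDiag {n : ℕ} {A : Module.End ℂ (Fin n → ℂ)}
    (b : Module.Basis (Fin n) ℂ (Fin n → ℂ)) (hb : (LinearMap.toMatrix b b A).IsDiag)
    (hμ : ∀ μ, A.HasEigenvalue μ → ‖μ‖ = 1) : HasBoundedPowers A := by
  set D := LinearMap.toMatrix b b A with hD
  have hAb : ∀ j, A (b j) = D j j • b j := by
    intro j
    apply b.repr.injective
    ext i
    rw [← LinearMap.toMatrix_apply b b A i j, ← hD]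
    rcases eq_or_ne i j with rfl | hij
    · simp
    · simp [hb hij, hij.symm]
  have hDj : ∀ j, ‖D j j‖ = 1 := fun j ↦ hμ _ (Module.End.hasEigenvalue_of_hasEigenvector
    (x := b j) ⟨Module.End.mem_eigenspace_iff.2 (hAb j), b.ne_zero j⟩)
  have hrepr : ∀ w i, b.equivFun (A w) i = D i i * b.equivFun w i := by
    intro w i
    have h := congrFun (LinearMap.toMatrix_mulVec_repr b b A w) i
    rw [← hD, Matrix.mulVec, dotProduct, Finset.sum_eq_single i] at h
    · exact h.symm
    · intro j _ hj
      simp [hb hj.symm]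
    · simp
  have hnorm : ∀ w, ‖b.equivFun (A w)‖ = ‖b.equivFun w‖ := by
    intro w
    simp only [Pi.norm_def]
    congr 1
    refine Finset.sup_congr rfl fun i _ ↦ ?_
    apply NNReal.eq
    simp [hrepr, hDj, -Module.Basis.equivFun_apply]
  have hnormn : ∀ (k : ℕ) w, ‖b.equivFun ((A ^ k) w)‖ = ‖b.equivFun w‖ := by
    intro k w
    induction k with
    | zero => simp
    | succ k ih => rw [pow_succ', Module.End.mul_apply, hnorm, ih]
  let L := b.equivFun.toContinuousLinearEquiv
  let S : (Fin n → ℂ) →L[ℂ] (Fin n → ℂ) := L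
  let S' : (Fin n → ℂ) →L[ℂ] (Fin n → ℂ) := L.symm
  have hbound : ∀ x y, ‖b.equivFun x‖ = ‖b.equivFun y‖ → ‖x‖ ≤ (‖S'‖ * ‖S‖ + 1) * ‖y‖ := by
    intro x y h
    have h1 : ‖x‖ ≤ ‖S'‖ * ‖b.equivFun x‖ := by
      have := S'.le_opNorm (L x)
      rwa [show S' (L x) = x from L.symm_apply_apply x] at this
    have h2 : ‖b.equivFun y‖ ≤ ‖S‖ * ‖y‖ := S.le_opNorm y
    calc ‖x‖ ≤ ‖S'‖ * ‖b.equivFun y‖ := by rw [← h]; exact h1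
      _ ≤ ‖S'‖ * (‖S‖ * ‖y‖) := by gcongr
      _ ≤ _ := by nlinarith [norm_nonneg y]
  exact ⟨‖S'‖ * ‖S‖ + 1, by positivity, fun k w ↦
    ⟨hbound _ _ (hnormn k w), hbound _ _ (hnormn k w).symm⟩⟩

end Complex

section Complexification

variable {d : ℕ} (γ : Matrix.SpecialLinearGroup (Fin (d + 1)) ℝ)

/-- The real linear map of `ℝ^{d+1}` with matrix `γ`. -/
noncomputable abbrev realMap : Module.End ℝ (Vec d) :=
  Matrix.toLin' (γ : Matrix (Fin (d + 1)) (Fin (d + 1)) ℝ)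

theorem complexify_pow_ofReal (n : ℕ) (v : Vec d) :
    (complexify γ ^ n) (fun i ↦ (v i : ℂ)) = fun i ↦ (((realMap γ ^ n) v i : ℝ) : ℂ) := by
  induction n with
  | zero => simp
  | succ n ih =>
    rw [pow_succ', Module.End.mul_apply, ih, pow_succ', Module.End.mul_apply]
    ext i
    simp [complexify, Matrix.mulVec, dotProduct]

theorem norm_ofReal_comp (v : Vec d) : ‖(fun i ↦ (v i : ℂ))‖ = ‖v‖ := by
  simp [Pi.norm_def]

theorem hasBoundedPowers_realMap_of_complexify (h : HasBoundedPowers (complexify γ)) :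
    HasBoundedPowers (realMap γ) := by
  obtain ⟨M, hM, h⟩ := h
  refine ⟨M, hM, fun n v ↦ ?_⟩
  have := h n (fun i ↦ (v i : ℂ))
  rwa [complexify_pow_ofReal, norm_ofReal_comp, norm_ofReal_comp] at this

theorem hasBoundedPowers_complexify (h : HasBoundedPowers (realMap γ)) :
    HasBoundedPowers (complexify γ) := by
  obtain ⟨M, hM, h⟩ := h
  have hdec : ∀ w : Fin (d + 1) → ℂ, w = (fun i ↦ ((w i).re : ℂ)) +
      Complex.I • fun i ↦ ((w i).im : ℂ) := by
    intro w
    ext i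
    simp [mul_comm Complex.I, Complex.re_add_im]
  have hre : ∀ w : Fin (d + 1) → ℂ, ‖fun i ↦ (w i).re‖ ≤ ‖w‖ := fun w ↦
    (pi_norm_le_iff_of_nonneg (norm_nonneg w)).2 fun i ↦
      (Complex.abs_re_le_norm (w i)).trans (norm_le_pi_norm w i)
  have him : ∀ w : Fin (d + 1) → ℂ, ‖fun i ↦ (w i).im‖ ≤ ‖w‖ := fun w ↦
    (pi_norm_le_iff_of_nonneg (norm_nonneg w)).2 fun i ↦
      (Complex.abs_im_le_norm (w i)).trans (norm_le_pi_norm w i)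
  have hsum : ∀ w : Fin (d + 1) → ℂ, ‖w‖ ≤ ‖fun i ↦ (w i).re‖ + ‖fun i ↦ (w i).im‖ := by
    intro w
    conv_lhs => rw [hdec w]
    refine (norm_add_le _ _).trans ?_
    rw [norm_smul, Complex.norm_I, one_mul, norm_ofReal_comp, norm_ofReal_comp]
  have hpow : ∀ n w, (complexify γ ^ n) w =
      (fun i ↦ (((realMap γ ^ n) (fun i ↦ (w i).re) i : ℝ) : ℂ)) +
      Complex.I • fun i ↦ (((realMap γ ^ n) (fun i ↦ (w i).im) i : ℝ) : ℂ) := by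
    intro n w
    conv_lhs => rw [hdec w]
    rw [map_add, map_smul, complexify_pow_ofReal, complexify_pow_ofReal]
  have hpre : ∀ n w, (fun i ↦ ((complexify γ ^ n) w i).re) =
      (realMap γ ^ n) (fun i ↦ (w i).re) := by
    intro n w; ext i; rw [hpow]; simp
  have hpim : ∀ n w, (fun i ↦ ((complexify γ ^ n) w i).im) =
      (realMap γ ^ n) (fun i ↦ (w i).im) := by
    intro n w; ext i; rw [hpow]; simp
  refine ⟨2 * M, by positivity, fun n w ↦ ⟨?_, ?_⟩⟩
  · refine (hsum _).trans ?_
    rw [hpre, hpim]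
    have h1 := (h n (fun i ↦ (w i).re)).1
    have h2 := (h n (fun i ↦ (w i).im)).1
    nlinarith [hre w, him w]
  · refine (hsum _).trans ?_
    have h1 := (h n (fun i ↦ (w i).re)).2
    have h2 := (h n (fun i ↦ (w i).im)).2
    rw [← hpre] at h1
    rw [← hpim] at h2
    nlinarith [hre ((complexify γ ^ n) w), him ((complexify γ ^ n) w)]

theorem isCircleSemisimple_iff_hasBoundedPowers :
    IsCircleSemisimple γ ↔ HasBoundedPowers (realMap γ) := by
  constructor
  · rintro ⟨⟨b, hb⟩, hμ⟩
    exact hasBoundedPowers_realMap_of_complexify γ (hasBoundedPowers_of_isDiag b hb hμ)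
  · intro h
    have h' := hasBoundedPowers_complexify γ h
    refine ⟨h'.exists_eigenbasis, fun μ hμ ↦ ?_⟩
    obtain ⟨w, hw⟩ := hμ.exists_hasEigenvector
    exact h'.norm_eigenvalue hw.apply_eq_smul hw.2

end Complexification

variable {d : ℕ}

theorem continuous_mk :
    Continuous fun v : {v : Vec d // v ≠ 0} ↦ (Projectivization.mk ℝ v.1 v.2 : ProjSpace d) :=
  continuous_quotient_mk'

theorem isClosed_of_isClosed_preimage_mk {A : Set (ProjSpace d)}
    (h : IsClosed {v : {v : Vec d // v ≠ 0} | Projectivization.mk ℝ v.1 v.2 ∈ A}) : IsClosed A :=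
  isQuotientMap_quotient_mk'.isClosed_preimage.1 h

theorem isOpen_preimageCone {Ω : Set (ProjSpace d)} (hΩ : IsOpen Ω) :
    IsOpen (preimageCone Ω) := by
  have h : preimageCone Ω =
      Subtype.val '' {v : {v : Vec d // v ≠ 0} | Projectivization.mk ℝ v.1 v.2 ∈ Ω} := by
    ext v
    simp [preimageCone]
  rw [h]
  exact (isOpen_ne (x := (0 : Vec d))).isOpenMap_subtype_val _ (hΩ.preimage continuous_mk)

theorem mk_mem_chart {f : Vec d →ₗ[ℝ] ℝ} {v : Vec d} (hv : v ≠ 0) :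
    Projectivization.mk ℝ v hv ∈ chart f ↔ f v ≠ 0 := by
  obtain ⟨a, ha⟩ := Projectivization.exists_smul_eq_mk_rep ℝ v hv
  change f (Projectivization.mk ℝ v hv).rep ≠ 0 ↔ _
  rw [← ha, Units.smul_def, map_smul, smul_eq_mul]
  simp

theorem mk_smul_eq {v : Vec d} (hv : v ≠ 0) {a : ℝ} (h : a • v ≠ 0) :
    Projectivization.mk ℝ (a • v) h = Projectivization.mk ℝ v hv :=
  (Projectivization.mk_eq_mk_iff' ℝ _ _ h hv).2 ⟨a, rfl⟩

theorem mk_coord {f : Vec d →ₗ[ℝ] ℝ} {x : ProjSpace d} (h : coord f x ≠ 0) :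
    Projectivization.mk ℝ (coord f x) h = x := by
  conv_rhs => rw [← x.mk_rep]
  exact mk_smul_eq x.rep_nonzero h

theorem smul_mem_preimageCone {Ω : Set (ProjSpace d)} {a : ℝ} (ha : a ≠ 0) {v : Vec d} :
    a • v ∈ preimageCone Ω ↔ v ∈ preimageCone Ω := by
  constructor
  · rintro ⟨h, hm⟩
    have hv : v ≠ 0 := fun h0 ↦ h (by simp [h0])
    exact ⟨hv, by rwa [mk_smul_eq hv] at hm⟩
  · rintro ⟨h, hm⟩
    have hv : a • v ≠ 0 := smul_ne_zero ha h
    exact ⟨hv, by rwa [mk_smul_eq h]⟩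

theorem neg_mem_preimageCone {Ω : Set (ProjSpace d)} {v : Vec d} :
    -v ∈ preimageCone Ω ↔ v ∈ preimageCone Ω := by
  simpa using smul_mem_preimageCone (Ω := Ω) (v := v) (neg_ne_zero.2 (one_ne_zero (α := ℝ)))

/-- The part of the preimage of `Ω` on which the linear form `g` is positive. -/
def positiveCone (Ω : Set (ProjSpace d)) (g : Vec d →ₗ[ℝ] ℝ) : Set (Vec d) :=
  {v | v ∈ preimageCone Ω ∧ 0 < g v}

theorem smul_mem_positiveCone {Ω : Set (ProjSpace d)} {g : Vec d →ₗ[ℝ] ℝ} {a : ℝ} (ha : 0 < a)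
    {v : Vec d} (hv : v ∈ positiveCone Ω g) : a • v ∈ positiveCone Ω g :=
  ⟨(smul_mem_preimageCone ha.ne').2 hv.1, by
    rw [map_smul, smul_eq_mul]; exact mul_pos ha hv.2⟩

theorem apply_ne_zero_of_mem_preimageCone {Ω : Set (ProjSpace d)} {g : Vec d →ₗ[ℝ] ℝ}
    (hg : Ω ⊆ chart g) {v : Vec d} (hv : v ∈ preimageCone Ω) : g v ≠ 0 := by
  obtain ⟨h0, h⟩ := hv
  exact (mk_mem_chart h0).1 (hg h)

theorem preimageCone_subset_union {Ω : Set (ProjSpace d)} {g : Vec d →ₗ[ℝ] ℝ}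
    (hg : Ω ⊆ chart g) : preimageCone Ω ⊆ positiveCone Ω g ∪ -positiveCone Ω g := by
  intro v hv
  rcases (apply_ne_zero_of_mem_preimageCone hg hv).lt_or_gt with h | h
  · exact Or.inr ⟨neg_mem_preimageCone.2 hv, by simpa using h⟩
  · exact Or.inl ⟨hv, h⟩

theorem convex_positiveCone_of_convex_coord {Ω : Set (ProjSpace d)} {f : Vec d →ₗ[ℝ] ℝ}
    (hc : Convex ℝ (coord f '' Ω)) : Convex ℝ (positiveCone Ω f) := by
  rintro v ⟨⟨hv0, hv⟩, hfv⟩ w ⟨⟨hw0, hw⟩, hfw⟩ a b ha hb hab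
  have hpos : 0 < f (a • v + b • w) := by
    simp only [map_add, map_smul, smul_eq_mul]
    rcases ha.eq_or_lt with rfl | ha
    · have : b = 1 := by linarith
      simpa [this] using hfw
    · have := mul_pos ha hfv
      have := mul_nonneg hb hfw.le
      linarith
  have h0 : a • v + b • w ≠ 0 := fun h ↦ by rw [h, map_zero] at hpos; exact hpos.false
  refine ⟨⟨h0, ?_⟩, hpos⟩
  set c := f (a • v + b • w) with hcdef
  have hc' : c = a * f v + b * f w := by simp [hcdef]
  obtain ⟨x, hx, hxe⟩ := hc ⟨_, hv, coord_mk f v hv0⟩ ⟨_, hw, coord_mk f w hw0⟩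
    (a := c⁻¹ * (a * f v)) (b := c⁻¹ * (b * f w)) (by positivity) (by positivity)
    (by rw [← mul_add, ← hc', inv_mul_cancel₀ hpos.ne'])
  have hxe' : coord f x = c⁻¹ • (a • v + b • w) := by
    rw [hxe, smul_smul, smul_smul, smul_add, smul_smul, smul_smul]
    congr 2 <;> field_simp
  have hx0 : coord f x ≠ 0 := by
    rw [hxe']; exact smul_ne_zero (inv_ne_zero hpos.ne') h0
  have hmk := mk_coord hx0
  have : Projectivization.mk ℝ (a • v + b • w) h0 = x := by
    rw [← hmk]
    exact (Projectivization.mk_eq_mk_iff' ℝ _ _ _ _).2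
      ⟨c, by rw [hxe', smul_smul, mul_inv_cancel₀ hpos.ne', one_smul]⟩
  rwa [this]

theorem positiveCone_neg (Ω : Set (ProjSpace d)) (g : Vec d →ₗ[ℝ] ℝ) :
    positiveCone Ω (-g) = -positiveCone Ω g := by
  ext v
  simp [positiveCone, neg_mem_preimageCone]

theorem positiveCone_eq_of_pos {Ω : Set (ProjSpace d)} {f g : Vec d →ₗ[ℝ] ℝ} (hf : Ω ⊆ chart f)
    (hg : ∀ v ∈ positiveCone Ω f, 0 < g v) : positiveCone Ω g = positiveCone Ω f := by
  refine Set.Subset.antisymm (fun v hv ↦ ?_) fun v hv ↦ ⟨hv.1, hg v hv⟩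
  rcases preimageCone_subset_union hf hv.1 with h | h
  · exact h
  · have := hg _ h
    rw [map_neg] at this
    linarith [hv.2]

theorem convex_positiveCone {Ω : Set (ProjSpace d)} (hc : IsConvex Ω) {g : Vec d →ₗ[ℝ] ℝ}
    (hg : Ω ⊆ chart g) : Convex ℝ (positiveCone Ω g) := by
  rcases hc with rfl | ⟨f, -, hf, hc⟩
  · have : positiveCone Set.univ g = {v : Vec d | 0 < g v} := by
      ext v
      refine ⟨fun h ↦ h.2, fun h ↦ ⟨⟨fun h0 ↦ ?_, trivial⟩, h⟩⟩
      simp [h0] at h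
    rw [this]
    exact convex_halfSpace_gt g.isLinear 0
  · have hC := convex_positiveCone_of_convex_coord hc
    have hne : ∀ v ∈ positiveCone Ω f, g v ≠ 0 := fun v hv ↦
      apply_ne_zero_of_mem_preimageCone hg hv.1
    by_cases hpos : ∀ v ∈ positiveCone Ω f, 0 < g v
    · rwa [positiveCone_eq_of_pos hf hpos]
    · push Not at hpos
      obtain ⟨w, hw, hgw⟩ := hpos
      have hgw' : g w < 0 := lt_of_le_of_ne hgw (hne w hw)
      have hneg : ∀ v ∈ positiveCone Ω f, 0 < (-g) v := by
        intro v hv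
        by_contra h
        have hgv : 0 < g v := lt_of_le_of_ne (by simpa using h) (hne v hv).symm
        have hs : 0 < g v - g w := by linarith
        refine hne _ (hC hv hw (a := (g v - g w)⁻¹ * (-g w)) (b := (g v - g w)⁻¹ * g v)
          (mul_nonneg (by positivity) (by linarith)) (by positivity) ?_) ?_
        · field_simp; ring
        · simp only [map_add, map_smul, smul_eq_mul]; ring
      have := positiveCone_eq_of_pos hf hneg
      rw [← neg_neg g, positiveCone_neg, this]
      exact hC.neg

theorem isConeAbove_positiveCone {Ω : Set (ProjSpace d)} (hΩ : IsOpen Ω) (hc : IsConvex Ω)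
    (hne : Ω.Nonempty) {g : Vec d →ₗ[ℝ] ℝ} (hg : Ω ⊆ chart g) :
    IsConeAbove Ω (positiveCone Ω g) := by
  have hgc : Continuous g := g.continuous_of_finiteDimensional
  have hopen : IsOpen (positiveCone Ω g) :=
    (isOpen_preimageCone hΩ).inter (isOpen_lt continuous_const hgc)
  obtain ⟨x, hx⟩ := hne
  have hv : x.rep ∈ preimageCone Ω := ⟨x.rep_nonzero, by rwa [x.mk_rep]⟩
  obtain ⟨v, hv⟩ : (positiveCone Ω g).Nonempty := by
    rcases preimageCone_subset_union hg hv with h | h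
    exacts [⟨_, h⟩, ⟨_, h⟩]
  refine ⟨v, hv.1, Set.Subset.antisymm ?_ ?_⟩
  · exact (convex_positiveCone hc hg).isPreconnected.subset_connectedComponentIn hv
      fun w hw ↦ hw.1
  · refine isPreconnected_connectedComponentIn.subset_left_of_subset_union hopen hopen.neg ?_
      ((connectedComponentIn_subset _ _).trans (preimageCone_subset_union hg))
      ⟨v, mem_connectedComponentIn hv.1, hv⟩
    refine Set.disjoint_left.2 fun w h1 h2 ↦ ?_
    have := h2.2
    rw [map_neg] at this
    linarith [h1.2]

/-- The cone `C` above `Ω` is open, convex and sharp: `g` is a positive linear form on `C` whose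
sections are bounded by `R`. -/
structure IsSharpConeOver (Ω : Set (ProjSpace d)) (C : Set (Vec d)) (g : Vec d →ₗ[ℝ] ℝ)
    (R : ℝ) : Prop where
  isOpen : IsOpen C
  convex : Convex ℝ C
  isConeAbove : IsConeAbove Ω C
  smul_mem : ∀ a : ℝ, 0 < a → ∀ v ∈ C, a • v ∈ C
  pos : ∀ v ∈ C, 0 < g v
  bound_pos : 0 < R
  bound : ∀ v ∈ C, ‖v‖ ≤ R * g v
  mem_iff : ∀ v, v ∈ preimageCone Ω ↔ v ∈ C ∨ -v ∈ C

theorem exists_isSharpConeOver {Ω : Set (ProjSpace d)} (hΩ : IsOpen Ω)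
    (hc : IsProperlyConvex Ω) (hne : Ω.Nonempty) : ∃ C g R, IsSharpConeOver Ω C g R := by
  obtain ⟨hc, g, -, hg, hb⟩ := hc
  obtain ⟨R, hR, hb⟩ := hb.exists_pos_norm_le
  have hgc : Continuous g := g.continuous_of_finiteDimensional
  refine ⟨positiveCone Ω g, g, R,
    (isOpen_preimageCone hΩ).inter (isOpen_lt continuous_const hgc),
    convex_positiveCone hc hg, isConeAbove_positiveCone hΩ hc hne hg,
    fun a ha v hv ↦ smul_mem_positiveCone ha hv, fun v hv ↦ hv.2, hR, ?_, fun v ↦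
    ⟨fun hv ↦ preimageCone_subset_union hg hv, ?_⟩⟩
  · rintro v ⟨⟨hv0, hv⟩, hgv⟩
    have := hb _ ⟨_, hv, rfl⟩
    rw [coord_mk, norm_smul, norm_inv, Real.norm_of_nonneg hgv.le, inv_mul_le_iff₀ hgv] at this
    linarith
  · rintro (h | h)
    exacts [h.1, neg_mem_preimageCone.1 h.1]

namespace IsSharpConeOver

variable {Ω : Set (ProjSpace d)} {C : Set (Vec d)} {g : Vec d →ₗ[ℝ] ℝ} {R : ℝ}

theorem ne_zero (h : IsSharpConeOver Ω C g R) {v : Vec d} (hv : v ∈ C) : v ≠ 0 := by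
  rintro rfl
  simpa using h.pos 0 hv

theorem mk_mem (h : IsSharpConeOver Ω C g R) {v : Vec d} (hv : v ∈ C) :
    Projectivization.mk ℝ v (h.ne_zero hv) ∈ Ω :=
  ((h.mem_iff v).2 (Or.inl hv)).2

theorem exists_rep (h : IsSharpConeOver Ω C g R) {x : ProjSpace d} (hx : x ∈ Ω) :
    ∃ v, ∃ hv : v ∈ C, g v = 1 ∧ Projectivization.mk ℝ v (h.ne_zero hv) = x := by
  have key : ∀ v ∈ C, ∀ hv0 : v ≠ 0, Projectivization.mk ℝ v hv0 = x →
      ∃ v, ∃ hv : v ∈ C, g v = 1 ∧ Projectivization.mk ℝ v (h.ne_zero hv) = x := by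
    intro v hv hv0 hvx
    have hgv := h.pos v hv
    have hm := h.smul_mem (g v)⁻¹ (inv_pos.2 hgv) v hv
    refine ⟨_, hm, by rw [map_smul, smul_eq_mul, inv_mul_cancel₀ hgv.ne'], ?_⟩
    rw [mk_smul_eq hv0, hvx]
  rcases (h.mem_iff x.rep).1 ⟨x.rep_nonzero, by rwa [x.mk_rep]⟩ with hv | hv
  · exact key _ hv x.rep_nonzero x.mk_rep
  · refine key _ hv (neg_ne_zero.2 x.rep_nonzero) ?_
    conv_rhs => rw [← x.mk_rep]
    exact (Projectivization.mk_eq_mk_iff' ℝ _ _ _ _).2 ⟨-1, by simp⟩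

theorem smul_mem_iff (h : IsSharpConeOver Ω C g R)
    {γ : Matrix.SpecialLinearGroup (Fin (d + 1)) ℝ} (hγ : γ ∈ Aut Ω) (v : Vec d) :
    γ • v ∈ C ↔ v ∈ C := by
  simp only [Aut, Subgroup.mem_iInf, MulAction.mem_stabilizer_iff] at hγ
  conv_lhs => rw [← hγ C h.isConeAbove]
  exact Set.smul_mem_smul_set_iff

theorem closure_subset_chart (h : IsSharpConeOver Ω C g R) : closure Ω ⊆ chart g := by
  let A : Set (ProjSpace d) := {x | ‖x.rep‖ ≤ R * |g x.rep|}
  have hA : ∀ (v : Vec d) (hv : v ≠ 0), Projectivization.mk ℝ v hv ∈ A ↔ ‖v‖ ≤ R * |g v| := by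
    intro v hv
    obtain ⟨a, ha⟩ := Projectivization.exists_smul_eq_mk_rep ℝ v hv
    have ha0 : 0 < |(a : ℝ)| := abs_pos.2 a.ne_zero
    change ‖(Projectivization.mk ℝ v hv).rep‖ ≤ R * |g (Projectivization.mk ℝ v hv).rep| ↔ _
    rw [← ha, Units.smul_def, map_smul, smul_eq_mul, norm_smul, abs_mul, Real.norm_eq_abs,
      mul_left_comm, mul_le_mul_iff_right₀ ha0]
  have hclosed : IsClosed A := by
    apply isClosed_of_isClosed_preimage_mk
    simp only [hA]
    have hgc : Continuous g := g.continuous_of_finiteDimensional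
    exact isClosed_le (by fun_prop) (by fun_prop)
  have hsub : Ω ⊆ A := by
    intro x hx
    obtain ⟨v, hv, -, rfl⟩ := h.exists_rep hx
    rw [hA, abs_of_pos (h.pos v hv)]
    exact h.bound v hv
  refine (closure_minimal hsub hclosed).trans fun x hx h0 ↦ x.rep_nonzero ?_
  have : ‖x.rep‖ ≤ R * |g x.rep| := hx
  rw [h0] at this
  simpa using this

/-- A line through two points of `Ω` leaves `Ω` at a boundary point. -/
theorem exists_frontier (h : IsSharpConeOver Ω C g R) (hΩ : IsOpen Ω) {v w : Vec d} (hv : v ∈ C)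
    (hw : w ∈ C) (hgv : g v = 1) (hgw : g w = 1) (hne : v ≠ w) :
    ∃ q ∈ frontier Ω, Sbtw ℝ v w (coord g q) := by
  let ℓ : ℝ → Vec d := fun t ↦ AffineMap.lineMap v w t
  have hℓ : Continuous ℓ := AffineMap.lineMap_continuous
  have hgℓ : ∀ t, g (ℓ t) = 1 := by
    intro t
    simp [ℓ, AffineMap.lineMap_apply, hgv, hgw]
  let s : Set ℝ := ℓ ⁻¹' C
  have hs : IsOpen s := h.isOpen.preimage hℓ
  have h1 : (1 : ℝ) ∈ s := by simpa [s, ℓ] using hw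
  have hd : 0 < ‖w - v‖ := norm_pos_iff.2 (sub_ne_zero.2 hne.symm)
  have hbdd : BddAbove s := by
    refine ⟨(R + ‖v‖) / ‖w - v‖, fun t ht ↦ ?_⟩
    rw [le_div_iff₀ hd]
    have h2 := h.bound _ ht
    rw [hgℓ, mul_one] at h2
    have h3 : t • (w - v) = ℓ t - v := by simp [ℓ, AffineMap.lineMap_apply]
    calc t * ‖w - v‖ ≤ |t| * ‖w - v‖ := by gcongr; exact le_abs_self t
      _ = ‖ℓ t - v‖ := by rw [← h3, norm_smul, Real.norm_eq_abs]
      _ ≤ ‖ℓ t‖ + ‖v‖ := norm_sub_le _ _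
      _ ≤ R + ‖v‖ := by gcongr
  set t₀ := sSup s with ht₀
  have hcl : t₀ ∈ closure s := csSup_mem_closure ⟨1, h1⟩ hbdd
  have hnot : t₀ ∉ s := by
    intro hmem
    obtain ⟨ε, hε, hball⟩ := Metric.isOpen_iff.1 hs t₀ hmem
    have : t₀ + ε / 2 ∈ s := hball (by
      rw [Metric.mem_ball, Real.dist_eq, add_sub_cancel_left, abs_of_pos (by positivity)]
      linarith)
    linarith [le_csSup hbdd this]
  have hlt : 1 < t₀ := lt_of_le_of_ne (le_csSup hbdd h1) fun he ↦ hnot (he ▸ h1)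
  have hℓ0 : ∀ t, ℓ t ≠ 0 := fun t h0 ↦ by simpa [h0] using hgℓ t
  refine ⟨Projectivization.mk ℝ (ℓ t₀) (hℓ0 t₀), ?_, ?_⟩
  · rw [hΩ.frontier_eq]
    constructor
    · have hcont : Continuous fun t ↦
          (Projectivization.mk ℝ (ℓ t) (hℓ0 t) : ProjSpace d) :=
        continuous_mk.comp (hℓ.subtype_mk hℓ0)
      exact map_mem_closure (f := fun t ↦ (Projectivization.mk ℝ (ℓ t) (hℓ0 t) : ProjSpace d))
        hcont hcl fun t ht ↦ h.mk_mem ht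
    · intro hmem
      rcases (h.mem_iff _).1 ⟨hℓ0 t₀, hmem⟩ with h' | h'
      · exact hnot h'
      · have := h.pos _ h'
        rw [map_neg, hgℓ] at this
        linarith
  · rw [coord_mk, hgℓ, inv_one, one_smul]
    have hw' : w = AffineMap.lineMap v (ℓ t₀) t₀⁻¹ := by
      have : t₀ ≠ 0 := by linarith
      simp [ℓ, AffineMap.lineMap_apply, smul_smul, this]
    have hvℓ : v ≠ ℓ t₀ := fun he ↦ hnot (show ℓ t₀ ∈ C from he ▸ hv)
    conv => enter [3]; rw [hw']
    exact sbtw_lineMap_iff.2 ⟨hvℓ, by positivity, inv_lt_one_of_one_lt₀ hlt⟩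

end IsSharpConeOver

theorem euclDist_lt_of_sbtw {p x y : Vec d} (h : Sbtw ℝ p x y) :
    0 < euclDist p x ∧ euclDist p x < euclDist p y := by
  have hpx : 0 < euclDist p x :=
    dist_pos.2 fun he ↦ h.ne_left (WithLp.toLp_injective 2 he).symm
  refine ⟨hpx, ?_⟩
  obtain ⟨t, ht, rfl⟩ := h.mem_image_Ioo
  have ht1 : euclDist p (AffineMap.lineMap p y t) = t * euclDist p y := by
    simp only [euclDist, dist_eq_norm]
    rw [← WithLp.toLp_sub, ← WithLp.toLp_sub, AffineMap.lineMap_apply, vsub_eq_sub, vadd_eq_add,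
      show p - (t • (y - p) + p) = t • (p - y) by module, WithLp.toLp_smul, norm_smul,
      Real.norm_of_nonneg ht.1.le]
  rw [ht1] at hpx ⊢
  have := pos_of_mul_pos_right hpx ht.1.le
  nlinarith [ht.2]

theorem IsHilbertValue.pos {Ω : Set (ProjSpace d)} {x y : ProjSpace d} {r : ℝ}
    (h : IsHilbertValue Ω x y r) : 0 < r := by
  obtain ⟨f, p, q, -, -, -, -, h1, h2, rfl⟩ := h
  obtain ⟨ha, hb⟩ := euclDist_lt_of_sbtw h1
  obtain ⟨hc, hd⟩ := euclDist_lt_of_sbtw h2.symm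
  have : 0 < Real.log
      ((euclDist (coord f p) (coord f y) * euclDist (coord f q) (coord f x)) /
        (euclDist (coord f p) (coord f x) * euclDist (coord f q) (coord f y))) := by
    apply Real.log_pos
    rw [one_lt_div (by positivity)]
    gcongr
  positivity

theorem hilbertDist_nonneg (Ω : Set (ProjSpace d)) (x y : ProjSpace d) :
    0 ≤ hilbertDist Ω x y := by
  unfold hilbertDist
  split_ifs with h
  · exact h.2.choose_spec.pos.le
  · exact le_rfl

theorem hilbertDist_self (Ω : Set (ProjSpace d)) (x : ProjSpace d) : hilbertDist Ω x x = 0 := by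
  simp [hilbertDist]

namespace IsSharpConeOver

variable {Ω : Set (ProjSpace d)} {C : Set (Vec d)} {g : Vec d →ₗ[ℝ] ℝ} {R : ℝ}

theorem exists_isHilbertValue (h : IsSharpConeOver Ω C g R) (hΩ : IsOpen Ω) {x y : ProjSpace d}
    (hx : x ∈ Ω) (hy : y ∈ Ω) (hxy : x ≠ y) : ∃ r, IsHilbertValue Ω x y r := by
  obtain ⟨v, hv, hgv, rfl⟩ := h.exists_rep hx
  obtain ⟨w, hw, hgw, rfl⟩ := h.exists_rep hy
  have hne : v ≠ w := by
    rintro rfl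
    exact hxy rfl
  obtain ⟨q, hq, hq'⟩ := h.exists_frontier hΩ hv hw hgv hgw hne
  obtain ⟨p, hp, hp'⟩ := h.exists_frontier hΩ hw hv hgw hgv hne.symm
  refine ⟨_, g, p, q, ?_, h.closure_subset_chart, hp, hq, ?_, ?_, rfl⟩
  · rintro rfl
    simp at hgv
  · rw [coord_mk, coord_mk, hgv, hgw, inv_one, one_smul, one_smul]
    exact hp'.symm
  · rw [coord_mk, coord_mk, hgv, hgw, inv_one, one_smul, one_smul]
    exact hq'

theorem hilbertDist_eq_zero_iff (h : IsSharpConeOver Ω C g R) (hΩ : IsOpen Ω)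
    {x y : ProjSpace d} (hx : x ∈ Ω) (hy : y ∈ Ω) : hilbertDist Ω x y = 0 ↔ x = y := by
  constructor
  · intro h0
    by_contra hxy
    have hex := h.exists_isHilbertValue hΩ hx hy hxy
    rw [hilbertDist, dif_pos ⟨hxy, hex⟩] at h0
    exact hex.choose_spec.pos.ne' h0
  · rintro rfl
    exact hilbertDist_self Ω x

theorem smul_mem_of_mem_aut (h : IsSharpConeOver Ω C g R)
    {γ : Matrix.SpecialLinearGroup (Fin (d + 1)) ℝ} (hγ : γ ∈ Aut Ω) {x : ProjSpace d}
    (hx : x ∈ Ω) : γ • x ∈ Ω := by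
  obtain ⟨v, hv, -, rfl⟩ := h.exists_rep hx
  rw [Projectivization.smul_mk]
  exact h.mk_mem ((h.smul_mem_iff hγ v).2 hv)

end IsSharpConeOver

theorem isElliptic_of_fixed {Ω : Set (ProjSpace d)}
    {γ : Matrix.SpecialLinearGroup (Fin (d + 1)) ℝ} {x : ProjSpace d} (hx : x ∈ Ω)
    (hγx : γ • x = x) : IsElliptic Ω γ := by
  have h0 : hilbertDist Ω x (γ • x) = 0 := by rw [hγx, hilbertDist_self]
  have hτ : translationLength Ω γ = 0 := by
    have : Nonempty Ω := ⟨⟨x, hx⟩⟩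
    apply le_antisymm
    · rw [← h0]
      exact ciInf_le ⟨0, by rintro _ ⟨y, rfl⟩; exact hilbertDist_nonneg _ _ _⟩ (⟨x, hx⟩ : Ω)
    · exact le_ciInf fun y ↦ hilbertDist_nonneg _ _ _
  exact ⟨hτ, x, hx, by rw [h0, hτ]⟩

theorem exists_fixed_iff_hasBoundedPowers {Ω : Set (ProjSpace d)} {C : Set (Vec d)}
    {g : Vec d →ₗ[ℝ] ℝ} {R : ℝ} (h : IsSharpConeOver Ω C g R) (hne : Ω.Nonempty)
    {γ : Matrix.SpecialLinearGroup (Fin (d + 1)) ℝ} (hγ : γ ∈ Aut Ω) :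
    (∃ x ∈ Ω, γ • x = x) ↔ HasBoundedPowers (realMap γ) := by
  have hC : ∀ v, realMap γ v ∈ C ↔ v ∈ C := h.smul_mem_iff hγ
  constructor
  · rintro ⟨x, hx, hγx⟩
    obtain ⟨v, hv, -, rfl⟩ := h.exists_rep hx
    rw [Projectivization.smul_mk, Projectivization.mk_eq_mk_iff'] at hγx
    obtain ⟨c, hc⟩ := hγx
    have hdet : LinearMap.det (realMap γ) = 1 := by
      rw [LinearMap.det_toLin', γ.det_coe]
    exact hasBoundedPowers_of_eigenvector_mem_cone hdet h.isOpen h.smul_mem h.bound_pos h.pos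
      h.bound hC hv (c := c) hc.symm (h.ne_zero hv)
  · intro hb
    obtain ⟨x, hx⟩ := hne
    obtain ⟨v, hv, -⟩ := h.exists_rep hx
    obtain ⟨w, hw, hγw⟩ := hb.exists_fixed_mem h.isOpen h.convex (fun v hv ↦ (hC v).2 hv) ⟨v, hv⟩
    refine ⟨_, h.mk_mem hw, ?_⟩
    rw [Projectivization.smul_mk, Projectivization.mk_eq_mk_iff']
    exact ⟨1, by rw [one_smul]; exact hγw.symm⟩

end HilbertGeometry

theorem mainTheorem5 (d : ℕ) (Ω : Set (HilbertGeometry.ProjSpace d))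
    (hΩ_open : IsOpen Ω) (hΩ_conv : HilbertGeometry.IsProperlyConvex Ω) (hΩ_ne : Ω.Nonempty)
    (γ : Matrix.SpecialLinearGroup (Fin (d + 1)) ℝ) (hγ : γ ∈ HilbertGeometry.Aut Ω) :
    List.TFAE [
      HilbertGeometry.IsElliptic Ω γ,
      ∃ x ∈ Ω, γ • x = x,
      HilbertGeometry.IsCircleSemisimple γ] := by
  obtain ⟨C, g, R, h⟩ := HilbertGeometry.exists_isSharpConeOver hΩ_open hΩ_conv hΩ_ne
  tfae_have 1 → 2 := by
    rintro ⟨hτ, x, hx, hd⟩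
    rw [hτ, h.hilbertDist_eq_zero_iff hΩ_open hx (h.smul_mem_of_mem_aut hγ hx)] at hd
    exact ⟨x, hx, hd.symm⟩
  tfae_have 2 → 1 := fun ⟨x, hx, hγx⟩ ↦ HilbertGeometry.isElliptic_of_fixed hx hγx
  tfae_have 2 ↔ 3 := by
    rw [HilbertGeometry.exists_fixed_iff_hasBoundedPowers h hΩ_ne hγ,
      HilbertGeometry.isCircleSemisimple_iff_hasBoundedPowers]
  tfae_finish
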